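/- Let $A$ be an associative unital ring. An $A$-group is a group $G$ with a map $A\times G\to G$, $(a,g)\mapsto g^a$, such that $g^0=1$, $g^1=g$, $1^a=1$, $g^{a+b}=g^ag^b$, $(g^a)^b=g^{ab}$, $(hgh^{-1})^a=hg^ah^{-1}$, and $(gh)^a=g^ah^a$ whenever $gh=hg$. Homomorphisms of $A$-groups are group homomorphisms preserving the powers $g\mapsto g^a$, and $A$-ideals are their kernels. The lower central $A$-series of $G$ is given by $G_0=G$ and $G_{n+1}=$ the smallest $A$-ideal of $G$ containing all commutators $[f,g]=f^{-1}g^{-1}fg$ with $f\in G$, $g\in G_n$. One says that $G$ is $A$-nilpotent if $G_n=1$ for some $n\in\mathbb N$, and residually $A$-nilpotent if $\bigcap_n G_n=1$; a quotient $M/N$ of $A$-ideals of $G$ is $A$-torsion-free if, for $g\in M$ and $a\in A\setminus\{0\}$, $g^a\in N$ implies $g\in N$. For an $A$-group $H$, let $y^A$ be the $A$-group obtained by writing the additive group of $A$ multiplicatively, with $(y^b)^a=y^{ba}$, let $H*^Ay^A$ be the free product (coproduct) of $A$-groups, and let $\alpha:H*^Ay^A\to A$ be the homomorphism with $\alpha(h)=0$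 for $h\in H$ and $\alpha(y)=1$. For a homomorphism of $A$-groups $\iota:H\to G$ and $g\in G$, the value $t(g)$ of $t\in H*^Ay^A$ is its image under the homomorphism $H*^Ay^A\to G$ that is $\iota$ on $H$ and sends $y$ to $g$. The completion $\widetilde H$ of $H$ is the $A$-group $\varprojlim_n H/H_n$. **Theorem 8.10.** Let $H$ be a residually $A$-nilpotent $A$-group such that all quotients $H_n/H_{n+1}$ are $A$-torsion-free. 1. There are a residually $A$-nilpotent $A$-group $G$ all of whose quotients $G_n/G_{n+1}$ are $A$-torsion-free, and an injective homomorphism of $A$-groups $H\to G$, such that for every $t\in H*^Ay^A$ with $\alpha(t)\in A^\times$ the equation $t(y)=1$ has a unique solution in $G$. 2. The completion $\widetilde H$ is a residually $A$-nilpotent $A$-group, the canonical homomorphism $H\to\widetilde H$ is injective, and for every $t\in H*^Ay^A$ with $\alpha(t)\in A^\times$ the equation $t(y)=1$ has a unique solution in $\widetilde H$. Moreover the closures $\overline{H_n}$ of the $H_n$ in $\widetilde H$ (for the inverse limit topology of the discrete groups $H/H_n$) form an $A$-series of $\widetilde H$: they are $A$-ideals of $\widetilde H$, $\overline{H_0}=\widetilde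 H$, $\overline{H_{n+1}}\subseteq\overline{H_n}$, $\bigcap_n\overline{H_n}=1$, and each $\overline{H_n}/\overline{H_{n+1}}$ is Abelian and $A$-torsion-free. 3. If $H$ is $A$-nilpotent, then for every $t\in H*^Ay^A$ with $\alpha(t)\in A^\times$ the equation $t(y)=1$ has a unique solution in $H$ itself. -/

import Mathlib

/-- An `A`-group (exponential group over the associative unital ring `A`): a group with
exponents in `A`. Here `apow g a` is `g ^ a`. -/
class AGroup (A : Type*) [Ring A] (G : Type*) [Group G] where
  apow : G → A → G
  apow_zero : ∀ g : G, apow g 0 = 1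
  apow_one : ∀ g : G, apow g 1 = g
  one_apow : ∀ a : A, apow 1 a = 1
  apow_add : ∀ (g : G) (a b : A), apow g (a + b) = apow g a * apow g b
  apow_apow : ∀ (g : G) (a b : A), apow (apow g a) b = apow g (a * b)
  conj_apow : ∀ (g h : G) (a : A), apow (h * g * h⁻¹) a = h * apow g a * h⁻¹
  mul_apow : ∀ (g h : G) (a : A), g * h = h * g → apow (g * h) a = apow g a * apow h a

namespace AGroup

/-- Homomorphisms of `A`-groups. -/
structure Hom (A : Type*) [Ring A] (G K : Type*) [Group G] [AGroup A G] [Group K] [AGroup A K]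
    extends G →* K where
  map_apow : ∀ (g : G) (a : A), toFun (apow g a) = apow (toFun g) a

instance (A : Type*) [Ring A] (G K : Type*) [Group G] [AGroup A G] [Group K] [AGroup A K] :
    CoeFun (Hom A G K) (fun _ => G → K) := ⟨fun f => f.toMonoidHom⟩

/-- The identity homomorphism. -/
def Hom.id (A : Type*) [Ring A] (G : Type*) [Group G] [AGroup A G] : Hom A G G where
  toMonoidHom := MonoidHom.id G
  map_apow := fun _ _ => rfl

/-- The trivial homomorphism. -/
def Hom.trivial (A : Type*) [Ring A] (G K : Type*) [Group G] [AGroup A G] [Group K]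
    [AGroup A K] : Hom A G K where
  toMonoidHom := 1
  map_apow := fun _ a => (one_apow a).symm

section Ideals

variable (A : Type*) [Ring A] {G : Type*} [Group G] [AGroup A G]

/-- `N` is an `A`-ideal: a normal `A`-subgroup modulo which commuting elements `f`, `g` satisfy
`(f g) ^ a = f ^ a g ^ a`. These are exactly the kernels of homomorphisms of `A`-groups. -/
structure IsIdeal (N : Subgroup G) : Prop where
  normal : N.Normal
  apow_mem : ∀ (g : G) (a : A), g ∈ N → apow g a ∈ N
  mul_apow_mem : ∀ (f g : G) (a : A), f⁻¹ * g⁻¹ * f * g ∈ N →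
    (apow g a)⁻¹ * (apow f a)⁻¹ * apow (f * g) a ∈ N

/-- The `A`-closure of a subset: the smallest `A`-ideal containing it. -/
def idealClosure (X : Set G) : Subgroup G := sInf {N | IsIdeal A N ∧ X ⊆ N}

theorem isIdeal_idealClosure (X : Set G) : IsIdeal A (idealClosure A X) where
  normal := ⟨fun g hg h => by
    simp only [idealClosure, Subgroup.mem_sInf] at hg ⊢
    exact fun N hN => hN.1.normal.conj_mem g (hg N hN) h⟩
  apow_mem := fun g a hg => by
    simp only [idealClosure, Subgroup.mem_sInf] at hg ⊢
    exact fun N hN => hN.1.apow_mem g a (hg N hN)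
  mul_apow_mem := fun f g a h => by
    simp only [idealClosure, Subgroup.mem_sInf] at h ⊢
    exact fun N hN => hN.1.mul_apow_mem f g a (h N hN)

theorem idealClosure_le {X : Set G} {N : Subgroup G} (hN : IsIdeal A N) (h : X ⊆ N) :
    idealClosure A X ≤ N := sInf_le ⟨hN, h⟩

variable {A} in
theorem apow_congr {N : Subgroup G} (hN : IsIdeal A N) (a : A) {f g : G}
    (h : f⁻¹ * g ∈ N) : (apow f a)⁻¹ * apow g a ∈ N := by
  have := hN.normal
  have key := hN.mul_apow_mem f (f⁻¹ * g) a (by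
    have h1 : (f⁻¹ * (f⁻¹ * g)⁻¹ * f⁻¹⁻¹) * (f⁻¹ * g) ∈ N :=
      N.mul_mem (hN.normal.conj_mem _ (N.inv_mem h) f⁻¹) h
    simpa [mul_assoc] using h1)
  have h2 := N.mul_mem (hN.apow_mem _ a h) key
  simpa [mul_assoc] using h2

variable {A} in
/-- The quotient of an `A`-group by an `A`-ideal, with `(g N) ^ a = g ^ a N`. -/
@[reducible] def quotient (N : Subgroup G) [N.Normal] (hN : IsIdeal A N) : AGroup A (G ⧸ N) where
  apow x a := Quotient.map' (fun g => apow g a) (fun f g h => by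
    rw [QuotientGroup.leftRel_apply] at h ⊢
    exact apow_congr hN a h) x
  apow_zero x := by
    induction x using QuotientGroup.induction_on with
    | H g => exact congrArg _ (apow_zero g)
  apow_one x := by
    induction x using QuotientGroup.induction_on with
    | H g => exact congrArg _ (apow_one g)
  one_apow a := congrArg (QuotientGroup.mk (s := N)) (one_apow a)
  apow_add x a b := by
    induction x using QuotientGroup.induction_on with
    | H g => exact congrArg _ (apow_add g a b)
  apow_apow x a b := by
    induction x using QuotientGroup.induction_on with
    | H g => exact congrArg _ (apow_apow g a b)
  conj_apow x y a := by
    induction x using QuotientGroup.induction_on with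
    | H g =>
      induction y using QuotientGroup.induction_on with
      | H h => exact congrArg _ (conj_apow g h a)
  mul_apow x y a hxy := by
    induction x using QuotientGroup.induction_on with
    | H g =>
      induction y using QuotientGroup.induction_on with
      | H h =>
        refine (QuotientGroup.eq.2 ?_).symm
        have h1 := QuotientGroup.eq.1 hxy.symm
        have h2 := hN.mul_apow_mem g h a (by simpa [mul_assoc] using h1)
        simpa [mul_assoc] using h2

end Ideals

section LowerCentral

variable (A : Type*) [Ring A] (G : Type*) [Group G] [AGroup A G]

/-- The lower central `A`-series: `G_0 = G` and `G_{n+1}` is the `A`-closure of `[G, G_n]`. -/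
def lowerCentral : ℕ → Subgroup G
  | 0 => ⊤
  | n + 1 => idealClosure A {x | ∃ f g : G, g ∈ lowerCentral n ∧ x = f⁻¹ * g⁻¹ * f * g}

theorem isIdeal_lowerCentral (n : ℕ) : IsIdeal A (lowerCentral A G n) := by
  cases n with
  | zero =>
    exact ⟨⟨fun _ _ _ => Subgroup.mem_top _⟩, fun _ _ _ => Subgroup.mem_top _,
      fun _ _ _ _ => Subgroup.mem_top _⟩
  | succ n => exact isIdeal_idealClosure A _

instance (n : ℕ) : (lowerCentral A G n).Normal := (isIdeal_lowerCentral A G n).normal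

theorem lowerCentral_succ_le (n : ℕ) : lowerCentral A G (n + 1) ≤ lowerCentral A G n := by
  refine idealClosure_le A (isIdeal_lowerCentral A G n) ?_
  rintro x ⟨f, g, hg, rfl⟩
  have h := (isIdeal_lowerCentral A G n).normal.conj_mem _
    ((lowerCentral A G n).inv_mem hg) f⁻¹
  simpa using (lowerCentral A G n).mul_mem h hg

/-- `G` is `A`-nilpotent. -/
def IsANilpotent : Prop := ∃ n, lowerCentral A G n = ⊥

/-- `G` is residually `A`-nilpotent. -/
def IsResiduallyANilpotent : Prop := ⨅ n, lowerCentral A G n = ⊥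

variable {G} in
/-- All quotients `s n / s (n + 1)` are `A`-torsion-free: `(g s_{n+1}) ^ a` is trivial, for
`a ≠ 0`, only if `g s_{n+1}` is. -/
def TorsionFreeQuotients (s : ℕ → Subgroup G) : Prop :=
  ∀ (n : ℕ) (g : G) (a : A), g ∈ s n → a ≠ 0 → apow g a ∈ s (n + 1) → g ∈ s (n + 1)

variable {G} in
/-- `s` is a (descending) `A`-series of length at most `ω` in `G`: `A`-ideals starting at `G`,
with trivial intersection, whose successive quotients are Abelian and `A`-torsion-free. -/
structure IsASeries (s : ℕ → Subgroup G) : Prop where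
  zero : s 0 = ⊤
  succ_le : ∀ n, s (n + 1) ≤ s n
  iInf_eq : ⨅ n, s n = ⊥
  isIdeal : ∀ n, IsIdeal A (s n)
  comm_mem : ∀ n, ∀ f ∈ s n, ∀ g ∈ s n, f⁻¹ * g⁻¹ * f * g ∈ s (n + 1)
  torsionFree : TorsionFreeQuotients A s

instance (n : ℕ) : AGroup A (G ⧸ lowerCentral A G n) :=
  quotient (lowerCentral A G n) (isIdeal_lowerCentral A G n)

/-- The projection `G / G_{n+1} → G / G_n`. -/
def transition (n : ℕ) : G ⧸ lowerCentral A G (n + 1) →* G ⧸ lowerCentral A G n :=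
  QuotientGroup.map _ _ (MonoidHom.id G) (lowerCentral_succ_le A G n)

/-- The inverse limit of the groups `G / G_n`, as a group of sequences. -/
def limitSubgroup : Subgroup (∀ n, G ⧸ lowerCentral A G n) where
  carrier := {x | ∀ n, transition A G n (x (n + 1)) = x n}
  one_mem' := fun n => map_one (transition A G n)
  mul_mem' := fun {x y} hx hy n => by
    simp only [Set.mem_ofPred_eq] at hx hy
    simp only [Pi.mul_apply, map_mul, hx n, hy n]
  inv_mem' := fun {x} hx n => by
    simp only [Set.mem_ofPred_eq] at hx
    simp only [Pi.inv_apply, map_inv, hx n]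

/-- The completion of `G` for the uniform structure of its lower central series (that is, of its
lower central valuation), realized as the inverse limit of the `A`-groups `G / G_n`. -/
def Completion : Type _ := limitSubgroup A G

instance : Group (Completion A G) := inferInstanceAs (Group (limitSubgroup A G))

theorem transition_apow (n : ℕ) (x : G ⧸ lowerCentral A G (n + 1)) (a : A) :
    transition A G n (apow x a) = apow (transition A G n x) a := by
  induction x using QuotientGroup.induction_on with
  | H g => rfl

/-- `A`-powers in the completion are taken in each `G / G_n`; they extend those of `G`
continuously. -/
instance : AGroup A (Completion A G) where
  apow x a := ⟨fun n => apow (x.1 n) a, fun n => by rw [transition_apow, x.2 n]⟩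
  apow_zero x := Subtype.ext (funext fun n => apow_zero (x.1 n))
  apow_one x := Subtype.ext (funext fun n => apow_one (x.1 n))
  one_apow a := Subtype.ext (funext fun _ => one_apow a)
  apow_add x a b := Subtype.ext (funext fun n => apow_add (x.1 n) a b)
  apow_apow x a b := Subtype.ext (funext fun n => apow_apow (x.1 n) a b)
  conj_apow x y a := Subtype.ext (funext fun n => conj_apow (x.1 n) (y.1 n) a)
  mul_apow x y a h := Subtype.ext (funext fun n => mul_apow (x.1 n) (y.1 n) a
    (congrFun (congrArg Subtype.val h) n))

/-- The canonical homomorphism from `G` to its completion. -/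
def toCompletion : Hom A G (Completion A G) where
  toFun g := ⟨fun _ => QuotientGroup.mk g, fun _ => rfl⟩
  map_one' := rfl
  map_mul' _ _ := rfl
  map_apow _ _ := rfl

/-- The topological closure of (the image of) `G_n` in the completion of `G`: a basic
neighbourhood of `x` consists of the elements with the same `m`-th coordinate as `x`. -/
def closureLowerCentral (n : ℕ) : Subgroup (Completion A G) where
  carrier := {x | ∀ m, ∃ g ∈ lowerCentral A G n, (toCompletion A G g).1 m = x.1 m}
  one_mem' := fun _ => ⟨1, one_mem _, rfl⟩
  mul_mem' := fun {x y} hx hy m => by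
    obtain ⟨g, hg, h1⟩ := hx m
    obtain ⟨h, hh, h2⟩ := hy m
    exact ⟨g * h, mul_mem hg hh, congrArg₂ (· * ·) h1 h2⟩
  inv_mem' := fun {x} hx m => by
    obtain ⟨g, hg, h1⟩ := hx m
    exact ⟨g⁻¹, inv_mem hg, congrArg (·⁻¹) h1⟩

end LowerCentral

section FreeProduct

/-- Formal expressions in elements of `G` and of `K`. -/
inductive FreeProdTerm (A G K : Type*) where
  | inl : G → FreeProdTerm A G K
  | inr : K → FreeProdTerm A G K
  | one : FreeProdTerm A G K
  | mul : FreeProdTerm A G K → FreeProdTerm A G K → FreeProdTerm A G K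
  | inv : FreeProdTerm A G K → FreeProdTerm A G K
  | pow : FreeProdTerm A G K → A → FreeProdTerm A G K

variable (A : Type*) [Ring A] (G K : Type*) [Group G] [AGroup A G] [Group K] [AGroup A K]

open FreeProdTerm in
/-- The congruence generated by the axioms of `A`-groups and by the condition that `inl` and
`inr` be homomorphisms of `A`-groups. -/
inductive FreeProdRel : FreeProdTerm A G K → FreeProdTerm A G K → Prop where
  | refl (s) : FreeProdRel s s
  | symm {s t} : FreeProdRel s t → FreeProdRel t s
  | trans {s t u} : FreeProdRel s t → FreeProdRel t u → FreeProdRel s u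
  | mul_congr {s s' t t'} : FreeProdRel s s' → FreeProdRel t t' →
      FreeProdRel (mul s t) (mul s' t')
  | inv_congr {s s'} : FreeProdRel s s' → FreeProdRel (inv s) (inv s')
  | pow_congr {s s'} (a : A) : FreeProdRel s s' → FreeProdRel (pow s a) (pow s' a)
  | mul_assoc (s t u) : FreeProdRel (mul (mul s t) u) (mul s (mul t u))
  | one_mul (s) : FreeProdRel (mul one s) s
  | mul_one (s) : FreeProdRel (mul s one) s
  | inv_mul (s) : FreeProdRel (mul (inv s) s) one
  | pow_zero (s) : FreeProdRel (pow s 0) one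
  | pow_one (s) : FreeProdRel (pow s 1) s
  | one_pow (a : A) : FreeProdRel (pow one a) one
  | pow_add (s) (a b : A) : FreeProdRel (pow s (a + b)) (mul (pow s a) (pow s b))
  | pow_pow (s) (a b : A) : FreeProdRel (pow (pow s a) b) (pow s (a * b))
  | conj_pow (s t) (a : A) : FreeProdRel (pow (mul (mul t s) (inv t)) a)
      (mul (mul t (pow s a)) (inv t))
  | mul_pow (s t) (a : A) : FreeProdRel (mul s t) (mul t s) →
      FreeProdRel (pow (mul s t) a) (mul (pow s a) (pow t a))
  | inl_mul (g h : G) : FreeProdRel (inl (g * h)) (mul (inl g) (inl h))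
  | inr_mul (g h : K) : FreeProdRel (inr (g * h)) (mul (inr g) (inr h))
  | inl_pow (g : G) (a : A) : FreeProdRel (inl (apow g a)) (pow (inl g) a)
  | inr_pow (g : K) (a : A) : FreeProdRel (inr (apow g a)) (pow (inr g) a)

/-- The setoid of the congruence. -/
def freeProdSetoid : Setoid (FreeProdTerm A G K) where
  r := FreeProdRel A G K
  iseqv := ⟨.refl, .symm, .trans⟩

/-- The free product `G *^A K` of the `A`-groups `G` and `K`, that is, their coproduct in the
category of `A`-groups. -/
def FreeProd : Type _ := Quotient (freeProdSetoid A G K)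

instance : Group (FreeProd A G K) where
  mul := Quotient.map₂ .mul (fun _ _ h _ _ h' => .mul_congr h h')
  one := Quotient.mk _ .one
  inv := Quotient.map .inv (fun _ _ h => .inv_congr h)
  mul_assoc := by rintro ⟨s⟩ ⟨t⟩ ⟨u⟩; exact Quotient.sound (.mul_assoc s t u)
  one_mul := by rintro ⟨s⟩; exact Quotient.sound (.one_mul s)
  mul_one := by rintro ⟨s⟩; exact Quotient.sound (.mul_one s)
  inv_mul_cancel := by rintro ⟨s⟩; exact Quotient.sound (.inv_mul s)

instance : AGroup A (FreeProd A G K) where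
  apow x a := Quotient.map (fun s => .pow s a) (fun _ _ h => .pow_congr a h) x
  apow_zero := by rintro ⟨s⟩; exact Quotient.sound (.pow_zero s)
  apow_one := by rintro ⟨s⟩; exact Quotient.sound (.pow_one s)
  one_apow a := Quotient.sound (.one_pow a)
  apow_add := by rintro ⟨s⟩ a b; exact Quotient.sound (.pow_add s a b)
  apow_apow := by rintro ⟨s⟩ a b; exact Quotient.sound (.pow_pow s a b)
  conj_apow := by rintro ⟨s⟩ ⟨t⟩ a; exact Quotient.sound (.conj_pow s t a)
  mul_apow := by
    rintro ⟨s⟩ ⟨t⟩ a h; exact Quotient.sound (.mul_pow s t a (Quotient.exact h))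

variable {A G K} {M : Type*} [Group M] [AGroup A M]

/-- The value of a formal expression in an `A`-group `M`, given homomorphisms to `M`. -/
def FreeProdTerm.value (f : Hom A G M) (k : Hom A K M) : FreeProdTerm A G K → M
  | inl g => f g
  | inr g => k g
  | one => 1
  | mul s t => s.value f k * t.value f k
  | inv s => (s.value f k)⁻¹
  | pow s a => apow (s.value f k) a

theorem FreeProdTerm.value_congr (f : Hom A G M) (k : Hom A K M) {s t : FreeProdTerm A G K}
    (h : FreeProdRel A G K s t) : s.value f k = t.value f k := by
  induction h with
  | refl s => rfl
  | symm _ ih => exact ih.symm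
  | trans _ _ ih ih' => exact ih.trans ih'
  | mul_congr _ _ ih ih' => exact congrArg₂ (· * ·) ih ih'
  | inv_congr _ ih => exact congrArg (·⁻¹) ih
  | pow_congr a _ ih => exact congrArg (fun x => apow x a) ih
  | mul_assoc s t u => exact _root_.mul_assoc _ _ _
  | one_mul s => exact _root_.one_mul _
  | mul_one s => exact _root_.mul_one _
  | inv_mul s => exact inv_mul_cancel _
  | pow_zero s => exact apow_zero _
  | pow_one s => exact apow_one _
  | one_pow a => exact one_apow _
  | pow_add s a b => exact apow_add _ _ _
  | pow_pow s a b => exact apow_apow _ _ _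
  | conj_pow s t a => exact conj_apow _ _ _
  | mul_pow s t a _ ih => exact mul_apow _ _ _ ih
  | inl_mul g h => exact f.map_mul g h
  | inr_mul g h => exact k.map_mul g h
  | inl_pow g a => exact f.map_apow g a
  | inr_pow g a => exact k.map_apow g a

/-- The homomorphism `G *^A K → M` given by the universal property. -/
def FreeProd.lift (f : Hom A G M) (k : Hom A K M) : Hom A (FreeProd A G K) M where
  toFun := Quotient.lift (FreeProdTerm.value f k) (fun _ _ h => FreeProdTerm.value_congr f k h)
  map_one' := rfl
  map_mul' := by rintro ⟨s⟩ ⟨t⟩; rfl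
  map_apow := by rintro ⟨s⟩ a; rfl

end FreeProduct

section Terms

variable (A : Type*) [Ring A]

/-- The `A`-group `y^A`, a multiplicative copy of the additive group of `A` with
`(y ^ b) ^ a = y ^ (b a)`. -/
abbrev VarGroup : Type _ := Multiplicative A

instance : AGroup A (VarGroup A) where
  apow x a := Multiplicative.ofAdd (x.toAdd * a)
  apow_zero x := congrArg Multiplicative.ofAdd (mul_zero x.toAdd)
  apow_one x := congrArg Multiplicative.ofAdd (mul_one x.toAdd)
  one_apow a := congrArg Multiplicative.ofAdd (zero_mul a)
  apow_add x a b := congrArg Multiplicative.ofAdd (mul_add x.toAdd a b)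
  apow_apow x a b := congrArg Multiplicative.ofAdd (mul_assoc x.toAdd a b)
  conj_apow x y a := by rw [mul_inv_cancel_comm, mul_inv_cancel_comm]
  mul_apow x y a _ := congrArg Multiplicative.ofAdd (add_mul x.toAdd y.toAdd a)

variable {A} {G : Type*} [Group G] [AGroup A G]

/-- The homomorphism `y^A → G` sending `y` to `g`. -/
def powHom (g : G) : Hom A (VarGroup A) G where
  toFun x := apow g x.toAdd
  map_one' := apow_zero g
  map_mul' x y := apow_add g x.toAdd y.toAdd
  map_apow x a := (apow_apow g x.toAdd a).symm

variable (A) (H : Type*) [Group H] [AGroup A H]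

/-- The `A`-group `H *^A y^A` of unary terms over `H`. -/
abbrev UnaryTerm : Type _ := FreeProd A H (VarGroup A)

variable {A H}

/-- The value `t(g)` of a term `t` over `H` at an element `g` of an `A`-group `G` to which `H`
is mapped by `ι`. -/
def UnaryTerm.eval (ι : Hom A H G) (g : G) (t : UnaryTerm A H) : G :=
  FreeProd.lift ι (powHom g) t

/-- The homomorphism `α : H *^A y^A → A` with `α(h) = 0` for `h ∈ H` and `α(y) = 1`. -/
def UnaryTerm.alpha (t : UnaryTerm A H) : A :=
  (FreeProd.lift (Hom.trivial A H (VarGroup A)) (Hom.id A (VarGroup A)) t).toAdd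

end Terms

end AGroup

universe u v

/-! The engine is one identity: if `z` is central, then `t(y z) = t(y) z ^ α(t)`, proved by
induction on formal expressions (`eval_mul_of_mem_center`). When `α(t)` has an inverse `b`, the only
central `z` with `t(y z) = 1` is therefore `(t(y)⁻¹) ^ b`. Hence unique solvability lifts along
every surjection with central kernel (`existsUnique_of_central`). Starting from the trivial group `H
/ H_0`, it climbs to every `H / H_n`. This settles the nilpotent case, and in the completion
uniqueness at each level makes the solutions a compatible sequence.

The completion need not serve as the group `G` of the first assertion: its lower central series is
only shown to lie inside the closures of the `H_n`. Instead, `G` is the `A`-subgroup of the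
completion generated by `H` and all the solutions. The correction `z` found above is, modulo
`G_{n+1}`, a power of a value of `t` on `H`; so every solution, and hence every element of `G`, is
congruent to an element of `H` modulo each `G_n` (`exists_inv_mul_mem_lowerCentral`,
`exists_mkLowerCentral_eq`). Since also `H ∩ G_n = H_n` (`of_mem_lowerCentral`), `G_n / G_{n+1}` is
a copy of `H_n / H_{n+1}` and inherits torsion-freeness. -/

namespace AGroup

/-! ### Homomorphisms, ideals, central elements and `A`-subgroups -/

section General

variable {A : Type*} [Ring A] {G K L : Type*} [Group G] [AGroup A G] [Group K] [AGroup A K]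
  [Group L] [AGroup A L]

/-- The composition of homomorphisms of `A`-groups. -/
def Hom.comp (g : Hom A K L) (f : Hom A G K) : Hom A G L where
  toMonoidHom := g.toMonoidHom.comp f.toMonoidHom
  map_apow x a := (congrArg g (f.map_apow x a)).trans (g.map_apow (f x) a)

theorem Hom.map_apow' (f : Hom A G K) (x : G) (a : A) : f (apow x a) = apow (f x) a :=
  f.map_apow x a

/-- The preimage of an `A`-ideal is an `A`-ideal. -/
theorem IsIdeal.comap {N : Subgroup K} (hN : IsIdeal A N) (f : Hom A G K) :
    IsIdeal A (N.comap f.toMonoidHom) where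
  normal := hN.normal.comap _
  apow_mem g a hg := by
    rw [Subgroup.mem_comap] at hg ⊢
    rw [f.map_apow']
    exact hN.apow_mem _ a hg
  mul_apow_mem x y a h := by
    rw [Subgroup.mem_comap] at h ⊢
    simp only [map_mul, map_inv, f.map_apow'] at h ⊢
    exact hN.mul_apow_mem _ _ a h

/-- The third ideal condition reduces here to the axiom on powers of commuting elements. Together
with `IsIdeal.comap`, this makes kernels of homomorphisms ideals. -/
theorem isIdeal_bot : IsIdeal A (⊥ : Subgroup G) where
  normal := inferInstance
  apow_mem g a hg := by
    rw [Subgroup.mem_bot] at hg ⊢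
    rw [hg, one_apow]
  mul_apow_mem f g a h := by
    rw [Subgroup.mem_bot] at h ⊢
    have hc : f * g = g * f := by
      have : (g * f)⁻¹ * (f * g) = 1 := by simpa [mul_assoc] using h
      exact (inv_mul_eq_one.1 this).symm
    rw [mul_apow f g a hc]
    group

/-- Conjugation commutes with powers, so whatever fixes `z` under conjugation also fixes its powers.
-/
theorem apow_mem_center {z : G} (hz : z ∈ Subgroup.center G) (a : A) :
    apow z a ∈ Subgroup.center G := by
  rw [Subgroup.mem_center_iff] at hz ⊢
  intro g
  have h := conj_apow z g a
  rw [hz g, mul_inv_cancel_right] at h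
  exact (eq_mul_inv_iff_mul_eq.1 h).symm

/-- The lower central `A`-series lies below every central series of `A`-ideals. -/
theorem lowerCentral_le {s : ℕ → Subgroup G} (h0 : s 0 = ⊤) (hs : ∀ n, IsIdeal A (s n))
    (hc : ∀ n, ∀ f g : G, g ∈ s n → f⁻¹ * g⁻¹ * f * g ∈ s (n + 1)) (n : ℕ) :
    lowerCentral A G n ≤ s n := by
  induction n with
  | zero => exact h0 ▸ le_top
  | succ n ih =>
    refine idealClosure_le A (hs _) ?_
    rintro x ⟨f, g, hg, rfl⟩
    exact hc n f g (ih hg)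

theorem commutator_mem_lowerCentral {n : ℕ} (f : G) {g : G} (hg : g ∈ lowerCentral A G n) :
    f⁻¹ * g⁻¹ * f * g ∈ lowerCentral A G (n + 1) := by
  simp only [lowerCentral, idealClosure, Subgroup.mem_sInf]
  exact fun N hN => hN.2 ⟨f, g, hg, rfl⟩

/-- The preimages of the `K_n` form a central series of ideals in `G`, so minimality of the lower
central series applies. -/
theorem Hom.map_mem_lowerCentral (f : Hom A G K) {n : ℕ} {g : G}
    (hg : g ∈ lowerCentral A G n) : f g ∈ lowerCentral A K n := by
  refine lowerCentral_le (s := fun n => (lowerCentral A K n).comap f.toMonoidHom)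
    (by simp [lowerCentral]) (fun n => (isIdeal_lowerCentral A K n).comap f) ?_ n hg
  intro n x y hy
  rw [Subgroup.mem_comap] at hy ⊢
  simp only [map_mul, map_inv]
  exact commutator_mem_lowerCentral _ hy

variable (A G) in
/-- The projection of an `A`-group to its quotient by a term of the lower central series. -/
def mkLowerCentral (n : ℕ) : Hom A G (G ⧸ lowerCentral A G n) where
  toMonoidHom := QuotientGroup.mk' _
  map_apow _ _ := rfl

theorem mkLowerCentral_eq_one {n : ℕ} {g : G} :
    mkLowerCentral A G n g = 1 ↔ g ∈ lowerCentral A G n :=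
  QuotientGroup.eq_one_iff g

theorem mkLowerCentral_surjective (n : ℕ) : Function.Surjective (mkLowerCentral A G n) :=
  QuotientGroup.mk'_surjective _

theorem mkLowerCentral_mem_center {n : ℕ} {g : G} (hg : g ∈ lowerCentral A G n) :
    mkLowerCentral A G (n + 1) g ∈ Subgroup.center _ := by
  rw [Subgroup.mem_center_iff]
  intro x
  obtain ⟨f, rfl⟩ := mkLowerCentral_surjective (A := A) (n + 1) x
  have h := mkLowerCentral_eq_one.2 (commutator_mem_lowerCentral f hg)
  simp only [map_mul, map_inv] at h
  rw [mul_assoc, ← mul_inv_rev, inv_mul_eq_one] at h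
  exact h.symm

variable (A G) in
/-- The projection `G / G_{n+1} → G / G_n` as a homomorphism of `A`-groups. -/
def transitionHom (n : ℕ) : Hom A (G ⧸ lowerCentral A G (n + 1)) (G ⧸ lowerCentral A G n) where
  toMonoidHom := transition A G n
  map_apow := transition_apow A G n

/-- An `A`-subgroup is an `A`-group. -/
@[reducible] def subgroup (S : Subgroup G) (hS : ∀ g ∈ S, ∀ a : A, apow g a ∈ S) : AGroup A S where
  apow x a := ⟨apow x.1 a, hS _ x.2 a⟩
  apow_zero x := Subtype.ext (apow_zero x.1)
  apow_one x := Subtype.ext (apow_one x.1)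
  one_apow a := Subtype.ext (one_apow a)
  apow_add x a b := Subtype.ext (apow_add x.1 a b)
  apow_apow x a b := Subtype.ext (apow_apow x.1 a b)
  conj_apow x y a := Subtype.ext (conj_apow x.1 y.1 a)
  mul_apow x y a h := Subtype.ext (mul_apow x.1 y.1 a (congrArg Subtype.val h))

variable (A) in
/-- The `A`-subgroup generated by a subset. -/
def closure (X : Set G) : Subgroup G :=
  sInf {S | X ⊆ S ∧ ∀ g ∈ S, ∀ a : A, apow g a ∈ S}

theorem subset_closure (X : Set G) : X ⊆ closure A X := by
  intro x hx
  simp only [closure, SetLike.mem_coe, Subgroup.mem_sInf]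
  exact fun S hS => hS.1 hx

theorem apow_mem_closure (X : Set G) : ∀ g ∈ closure A X, ∀ a : A, apow g a ∈ closure A X := by
  intro g hg a
  simp only [closure, Subgroup.mem_sInf] at hg ⊢
  exact fun S hS => hS.2 g (hg S hS) a

theorem closure_le {X : Set G} {S : Subgroup G} (hX : X ⊆ S)
    (hS : ∀ g ∈ S, ∀ a : A, apow g a ∈ S) : closure A X ≤ S := sInf_le ⟨hX, hS⟩

end General

/-! ### Equations and central extensions -/

namespace UnaryTerm

variable {A : Type*} [Ring A] {H G K L : Type*} [Group H] [AGroup A H] [Group G] [AGroup A G]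
  [Group K] [AGroup A K] [Group L] [AGroup A L]

theorem map_eval (p : Hom A K L) (ι : Hom A H K) (y : K) (t : UnaryTerm A H) :
    p (t.eval ι y) = t.eval (p.comp ι) (p y) := by
  obtain ⟨t⟩ := t
  change p (t.value _ _) = t.value _ _
  induction t with
  | inl h => rfl
  | inr b => exact p.map_apow _ _
  | one => exact map_one _
  | mul s t hs ht => exact (map_mul _ _ _).trans (congrArg₂ (· * ·) hs ht)
  | inv s hs => exact (map_inv _ _).trans (congrArg _ hs)
  | pow s a hs => exact (p.map_apow _ _).trans (congrArg (apow · a) hs)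

/-- Multiplying the argument by a central element multiplies the value by its `α(t)`-th power. -/
theorem eval_mul_of_mem_center (ι : Hom A H K) (y : K) {z : K} (hz : z ∈ Subgroup.center K)
    (t : UnaryTerm A H) : t.eval ι (y * z) = t.eval ι y * apow z t.alpha := by
  obtain ⟨t⟩ := t
  -- The exponent is read off the formal expression representing `t`, so that structural induction
  -- is available.
  set α : FreeProdTerm A H (VarGroup A) → A := fun t =>
    (t.value (Hom.trivial A H (VarGroup A)) (Hom.id A (VarGroup A))).toAdd
  change t.value _ _ = t.value _ _ * apow z (α t)
  have comm (g : K) (a : A) : g * apow z a = apow z a * g :=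
    Subgroup.mem_center_iff.1 (apow_mem_center hz a) g
  induction t with
  | inl h => exact (mul_one _).symm.trans (congrArg _ (apow_zero z).symm)
  | inr b => exact mul_apow y z _ (Subgroup.mem_center_iff.1 hz y)
  | one => exact (one_mul _).symm.trans (congrArg _ (apow_zero z).symm)
  | mul s t hs ht =>
    have e : apow z (α (s.mul t)) = apow z (α s) * apow z (α t) := apow_add z (α s) (α t)
    rw [e]
    simp only [FreeProdTerm.value]
    rw [hs, ht, mul_assoc, ← mul_assoc _ _ (apow z (α t)), ← comm]
    simp only [mul_assoc]
  | inv s hs =>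
    have e : apow z (α s.inv) = (apow z (α s))⁻¹ := by
      have : α s.inv = -α s := rfl
      rw [this, eq_inv_iff_mul_eq_one, ← apow_add, neg_add_cancel, apow_zero]
    rw [e]
    simp only [FreeProdTerm.value]
    rw [hs, comm, mul_inv_rev]
  | pow s a hs =>
    have e : apow z (α (s.pow a)) = apow (apow z (α s)) a := (apow_apow z (α s) a).symm
    rw [e]
    simp only [FreeProdTerm.value]
    -- The power distributes over the product because the second factor is a power of `z`, hence
    -- central.
    rw [hs, mul_apow _ _ _ (comm _ _)]

/-- If `α(t)` is invertible and `y z` is a solution with `z` central, then `z` is determined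
by `t(y)`. -/
theorem eval_mul_eq_one_iff (ι : Hom A H K) (y : K) {z : K} (hz : z ∈ Subgroup.center K)
    {t : UnaryTerm A H} {b : A} (hb : t.alpha * b = 1) (hb' : b * t.alpha = 1) :
    t.eval ι (y * z) = 1 ↔ z = apow (t.eval ι y)⁻¹ b := by
  rw [eval_mul_of_mem_center ι y hz, mul_eq_one_iff_inv_eq]
  constructor
  · intro h
    rw [h, apow_apow, hb, apow_one]
  · rintro rfl
    rw [apow_apow, hb', apow_one]

/-- Unique solvability lifts along surjections with central kernel. -/
theorem existsUnique_of_central (p : Hom A K L) (hp : Function.Surjective p)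
    (hker : ∀ z, p z = 1 → z ∈ Subgroup.center K) (ι : Hom A H K) {t : UnaryTerm A H}
    (ht : IsUnit t.alpha) (h : ∃! y : L, t.eval (p.comp ι) y = 1) :
    ∃! y : K, t.eval ι y = 1 := by
  obtain ⟨b, hb, hb'⟩ := isUnit_iff_exists.1 ht
  obtain ⟨y₀, hy₀, huniq⟩ := h
  obtain ⟨y, rfl⟩ := hp y₀
  -- The correcting factor lies in the kernel, hence is central, because `t(y)` already dies in `L`.
  have key : p (apow (t.eval ι y)⁻¹ b) = 1 := by
    have e : p (t.eval ι y) = 1 := (map_eval p ι y t).trans hy₀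
    rw [p.map_apow', map_inv, e, inv_one, one_apow]
  refine ⟨y * apow (t.eval ι y)⁻¹ b, (eval_mul_eq_one_iff ι y (hker _ key) hb hb').2 rfl, ?_⟩
  intro x hx
  have hpx : p x = p y := huniq _ ((map_eval p ι x t).symm.trans
    ((congrArg p hx).trans (map_one _)))
  have hz : y⁻¹ * x ∈ Subgroup.center K := hker _ (by rw [map_mul, map_inv, hpx, inv_mul_cancel])
  rw [← (eval_mul_eq_one_iff ι y hz hb hb').1 (by rwa [mul_inv_cancel_left]),
    mul_inv_cancel_left]

/-- Equations over `H` with `α(t)` invertible are uniquely solvable in each `H / H_n`. -/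
theorem existsUnique_quotient {t : UnaryTerm A H} (ht : IsUnit t.alpha) (n : ℕ) :
    ∃! y : H ⧸ lowerCentral A H n, t.eval (mkLowerCentral A H n) y = 1 := by
  induction n with
  | zero =>
    have hs (x : H ⧸ lowerCentral A H 0) : x = 1 := by
      obtain ⟨g, rfl⟩ := mkLowerCentral_surjective (A := A) 0 x
      exact mkLowerCentral_eq_one.2 (Subgroup.mem_top g)
    exact ⟨1, hs _, fun y _ => hs y⟩
  | succ n ih =>
    refine existsUnique_of_central (transitionHom A H n) ?_ ?_ (mkLowerCentral A H (n + 1)) ht ih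
    · intro x
      obtain ⟨g, rfl⟩ := mkLowerCentral_surjective (A := A) n x
      exact ⟨mkLowerCentral A H (n + 1) g, rfl⟩
    · intro z hz
      obtain ⟨g, rfl⟩ := mkLowerCentral_surjective (A := A) (n + 1) z
      exact mkLowerCentral_mem_center (mkLowerCentral_eq_one.1 hz)

/-- If `H_n = 1`, the projection to `H / H_n` has trivial, hence central, kernel, and one more
lifting reaches `H`. -/
theorem existsUnique_of_isANilpotent (hH : IsANilpotent A H) {t : UnaryTerm A H}
    (ht : IsUnit t.alpha) : ∃! y : H, t.eval (Hom.id A H) y = 1 := by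
  obtain ⟨n, hn⟩ := hH
  refine existsUnique_of_central (mkLowerCentral A H n) (mkLowerCentral_surjective n) ?_
    (Hom.id A H) ht (existsUnique_quotient ht n)
  intro z hz
  rw [mkLowerCentral_eq_one, hn, Subgroup.mem_bot] at hz
  exact hz ▸ one_mem _

/-- A solution over `H` in an `A`-group `G` lies in `H G_n` for every `n`. -/
theorem exists_inv_mul_mem_lowerCentral (ι : Hom A H G) {t : UnaryTerm A H} (ht : IsUnit t.alpha)
    {y : G} (hy : t.eval ι y = 1) (n : ℕ) : ∃ h : H, (ι h)⁻¹ * y ∈ lowerCentral A G n := by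
  obtain ⟨b, hb, hb'⟩ := isUnit_iff_exists.1 ht
  induction n with
  | zero => exact ⟨1, Subgroup.mem_top _⟩
  | succ n ih =>
    obtain ⟨h, hh⟩ := ih
    -- Modulo `G_{n+1}`, `y` is `h` times a central element, which must be `(t(h)⁻¹) ^ b`. This
    -- correction comes from `H`, as `t` has its coefficients there.
    refine ⟨h * apow (t.eval (Hom.id A H) h)⁻¹ b, ?_⟩
    set p := mkLowerCentral A G (n + 1)
    have h1 : t.eval (p.comp ι) (p (ι h) * p ((ι h)⁻¹ * y)) = 1 := by
      rw [← map_mul, mul_inv_cancel_left, ← map_eval, hy, map_one]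
    have h2 := (eval_mul_eq_one_iff _ _ (mkLowerCentral_mem_center hh) hb hb').1 h1
    have h3 : t.eval (p.comp ι) (p (ι h)) = p (ι (t.eval (Hom.id A H) h)) := by
      rw [map_eval, map_eval]
      rfl
    have h4 : p ((ι h)⁻¹ * y) = p (ι (apow (t.eval (Hom.id A H) h)⁻¹ b)) := by
      rw [ι.map_apow', p.map_apow', map_inv ι.toMonoidHom, map_inv p.toMonoidHom, ← h3]
      exact h2
    apply mkLowerCentral_eq_one.1
    change p _ = 1
    rw [map_mul ι.toMonoidHom, mul_inv_rev, mul_assoc, map_mul p.toMonoidHom, h4, ← map_mul,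
      inv_mul_cancel, map_one]

end UnaryTerm

/-! ### The completion and the closures of the lower central series -/

namespace Completion

variable (A : Type*) [Ring A] (H : Type*) [Group H] [AGroup A H]

/-- The projection of the completion to `H / H_n`. -/
def proj (n : ℕ) : Hom A (Completion A H) (H ⧸ lowerCentral A H n) where
  toFun x := x.1 n
  map_one' := rfl
  map_mul' _ _ := rfl
  map_apow _ _ := rfl

variable {A H}

theorem ext {x y : Completion A H} (h : ∀ n, proj A H n x = proj A H n y) : x = y :=
  Subtype.ext (funext h)

theorem proj_eq_of_le {x : Completion A H} {g : H} {m n : ℕ} (hmn : m ≤ n)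
    (h : proj A H n x = mkLowerCentral A H n g) : proj A H m x = mkLowerCentral A H m g := by
  induction n, hmn using Nat.le_induction with
  | base => exact h
  | succ n _ ih => exact ih ((x.2 n).symm.trans (congrArg (transition A H n) h))

/-- Identifies the closure of `H_n` with the kernel of the projection to `H / H_n`; the ideal and
series properties follow from this description. -/
theorem mem_closureLowerCentral {n : ℕ} {x : Completion A H} :
    x ∈ closureLowerCentral A H n ↔ proj A H n x = 1 := by
  constructor
  · intro h
    obtain ⟨g, hg, e⟩ := h n
    exact e.symm.trans (mkLowerCentral_eq_one.2 hg)
  · intro h m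
    -- At level `max m n` a single representative controls both coordinates: the `n`-th puts it in
    -- `H_n`, the `m`-th gives the approximation.
    obtain ⟨g, hg⟩ := mkLowerCentral_surjective (A := A) (max m n) (proj A H (max m n) x)
    refine ⟨g, mkLowerCentral_eq_one.1 ?_, ?_⟩
    · rw [← proj_eq_of_le (le_max_right m n) hg.symm, h]
    · exact (proj_eq_of_le (le_max_left m n) hg.symm).symm

theorem closureLowerCentral_eq_comap (n : ℕ) :
    closureLowerCentral A H n = (⊥ : Subgroup _).comap (proj A H n).toMonoidHom :=
  Subgroup.ext fun _ => mem_closureLowerCentral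

theorem isIdeal_closureLowerCentral (n : ℕ) : IsIdeal A (closureLowerCentral A H n) := by
  rw [closureLowerCentral_eq_comap]
  exact isIdeal_bot.comap _

theorem closureLowerCentral_zero : closureLowerCentral A H 0 = ⊤ := by
  refine eq_top_iff.2 fun x _ => mem_closureLowerCentral.2 ?_
  obtain ⟨g, hg⟩ := mkLowerCentral_surjective (A := A) 0 (proj A H 0 x)
  exact hg.symm.trans (mkLowerCentral_eq_one.2 (Subgroup.mem_top g))

theorem exists_lift {x : Completion A H} {n : ℕ} (hx : x ∈ closureLowerCentral A H n) :
    ∃ g ∈ lowerCentral A H n, mkLowerCentral A H (n + 1) g = proj A H (n + 1) x := hx (n + 1)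

theorem commutator_mem_closureLowerCentral {n : ℕ} (f : Completion A H) {g : Completion A H}
    (hg : g ∈ closureLowerCentral A H n) :
    f⁻¹ * g⁻¹ * f * g ∈ closureLowerCentral A H (n + 1) := by
  obtain ⟨k, hk, e⟩ := exists_lift hg
  have hc := Subgroup.mem_center_iff.1 (mkLowerCentral_mem_center hk) (proj A H (n + 1) f)
  rw [e] at hc
  rw [mem_closureLowerCentral]
  simp only [map_mul, map_inv]
  rw [mul_assoc, hc]
  group

theorem iInf_closureLowerCentral : ⨅ n, closureLowerCentral A H n = ⊥ := by
  refine eq_bot_iff.2 fun x hx => ?_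
  rw [Subgroup.mem_iInf] at hx
  exact ext fun n => (mem_closureLowerCentral.1 (hx n)).trans (map_one _).symm

theorem lowerCentral_le_closureLowerCentral (n : ℕ) :
    lowerCentral A (Completion A H) n ≤ closureLowerCentral A H n :=
  lowerCentral_le closureLowerCentral_zero isIdeal_closureLowerCentral
    (fun _ f _ hg => commutator_mem_closureLowerCentral f hg) n

variable (A H) in
theorem isResiduallyANilpotent : IsResiduallyANilpotent A (Completion A H) :=
  eq_bot_iff.2 ((iInf_mono lowerCentral_le_closureLowerCentral).trans
    iInf_closureLowerCentral.le)

theorem isASeries (htf : TorsionFreeQuotients A (lowerCentral A H)) :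
    IsASeries A (closureLowerCentral A H) where
  zero := closureLowerCentral_zero
  succ_le n x hx := by
    rw [mem_closureLowerCentral] at hx ⊢
    exact proj_eq_of_le (g := 1) n.le_succ (hx.trans (map_one _).symm)
  iInf_eq := iInf_closureLowerCentral
  isIdeal := isIdeal_closureLowerCentral
  comm_mem _ f _ _ hg := commutator_mem_closureLowerCentral f hg
  torsionFree n x a hx ha h := by
    obtain ⟨g, hg, e⟩ := exists_lift hx
    rw [mem_closureLowerCentral] at h ⊢
    rw [Hom.map_apow', ← e, ← Hom.map_apow', mkLowerCentral_eq_one] at h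
    rw [← e, mkLowerCentral_eq_one]
    exact htf n g a hg ha h

theorem toCompletion_mem_closureLowerCentral {n : ℕ} {h : H} :
    toCompletion A H h ∈ closureLowerCentral A H n ↔ h ∈ lowerCentral A H n :=
  mem_closureLowerCentral.trans mkLowerCentral_eq_one

theorem toCompletion_injective (hres : IsResiduallyANilpotent A H) :
    Function.Injective (toCompletion A H) := by
  refine (injective_iff_map_eq_one (toCompletion A H).toMonoidHom).2 fun h hh => ?_
  have : h ∈ ⨅ n, lowerCentral A H n := by
    rw [Subgroup.mem_iInf]
    intro n
    rw [← toCompletion_mem_closureLowerCentral]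
    exact hh ▸ one_mem _
  rwa [hres, Subgroup.mem_bot] at this

theorem existsUnique_eval_eq_one {t : UnaryTerm A H} (ht : IsUnit t.alpha) :
    ∃! y : Completion A H, t.eval (toCompletion A H) y = 1 := by
  choose y hy huniq using fun n => UnaryTerm.existsUnique_quotient ht n
  -- The image of the solution at level `n + 1` solves the equation at level `n`, so uniqueness
  -- forces compatibility.
  have hmem (n : ℕ) : transition A H n (y (n + 1)) = y n :=
    huniq n _ ((UnaryTerm.map_eval (transitionHom A H n) (mkLowerCentral A H (n + 1))
      (y (n + 1)) t).symm.trans ((congrArg _ (hy (n + 1))).trans (map_one _)))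
  let y' : Completion A H := ⟨y, show y ∈ limitSubgroup A H from hmem⟩
  refine ⟨y', ext fun n => ?_, fun x hx => ext fun n => huniq n _ ?_⟩
  · exact (UnaryTerm.map_eval (proj A H n) (toCompletion A H) y' t).trans
      ((hy n).trans (map_one _).symm)
  · have := UnaryTerm.map_eval (proj A H n) (toCompletion A H) x t
    rw [hx, map_one] at this
    exact this.symm

/-! ### The subgroup of the completion generated by solutions -/

variable (A H) in
/-- The generators of the solution subgroup: elements of `H` and solutions of equations over
`H`. -/
def solutionSet : Set (Completion A H) :=
  Set.range (toCompletion A H) ∪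
    {y | ∃ t : UnaryTerm A H, IsUnit t.alpha ∧ t.eval (toCompletion A H) y = 1}

variable (A H) in
/-- The `A`-subgroup of the completion generated by `H` and the solutions of equations over `H`
with `α(t)` invertible. -/
def SolutionGroup : Type _ := closure A (solutionSet A H)

namespace SolutionGroup

instance : Group (SolutionGroup A H) := inferInstanceAs (Group (closure A (solutionSet A H)))

instance : AGroup A (SolutionGroup A H) := subgroup _ (apow_mem_closure (solutionSet A H))

variable (A H) in
/-- The inclusion into the completion. -/
def incl : Hom A (SolutionGroup A H) (Completion A H) where
  toMonoidHom := (closure A (solutionSet A H)).subtype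
  map_apow _ _ := rfl

variable (A H) in
/-- The homomorphism from `H`. -/
def of : Hom A H (SolutionGroup A H) where
  toFun h := ⟨toCompletion A H h, subset_closure _ (Or.inl ⟨h, rfl⟩)⟩
  map_one' := rfl
  map_mul' _ _ := rfl
  map_apow _ _ := rfl

theorem incl_injective : Function.Injective (incl A H) := Subtype.val_injective

theorem incl_eval (t : UnaryTerm A H) (y : SolutionGroup A H) :
    incl A H (t.eval (of A H) y) = t.eval (toCompletion A H) (incl A H y) :=
  UnaryTerm.map_eval _ _ _ _

theorem eval_eq_one_iff {t : UnaryTerm A H} {y : SolutionGroup A H} :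
    t.eval (of A H) y = 1 ↔ t.eval (toCompletion A H) (incl A H y) = 1 := by
  rw [← incl_eval]
  exact (map_eq_one_iff (incl A H).toMonoidHom incl_injective).symm

theorem existsUnique_eval_eq_one {t : UnaryTerm A H} (ht : IsUnit t.alpha) :
    ∃! y : SolutionGroup A H, t.eval (of A H) y = 1 := by
  obtain ⟨y, hy, huniq⟩ := Completion.existsUnique_eval_eq_one ht
  refine ⟨⟨y, subset_closure _ (Or.inr ⟨t, ht, hy⟩)⟩, eval_eq_one_iff.2 hy, fun x hx => ?_⟩
  exact incl_injective (huniq _ (eval_eq_one_iff.1 hx))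

theorem incl_mem_closureLowerCentral {n : ℕ} {x : SolutionGroup A H}
    (hx : x ∈ lowerCentral A (SolutionGroup A H) n) :
    incl A H x ∈ closureLowerCentral A H n :=
  lowerCentral_le_closureLowerCentral n ((incl A H).map_mem_lowerCentral hx)

/-- For the nontrivial direction, the completion serves as a detour: `G_n` lands in the closure of
`H_n`, which meets `H` only in `H_n`. -/
theorem of_mem_lowerCentral {n : ℕ} {h : H} :
    of A H h ∈ lowerCentral A (SolutionGroup A H) n ↔ h ∈ lowerCentral A H n :=
  ⟨fun hh => toCompletion_mem_closureLowerCentral.1 (incl_mem_closureLowerCentral hh),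
    (of A H).map_mem_lowerCentral⟩

variable (A H) in
theorem isResiduallyANilpotent : IsResiduallyANilpotent A (SolutionGroup A H) := by
  refine eq_bot_iff.2 fun x hx => ?_
  rw [Subgroup.mem_iInf] at hx
  have : incl A H x ∈ ⨅ n, closureLowerCentral A H n :=
    Subgroup.mem_iInf.2 fun n => incl_mem_closureLowerCentral (hx n)
  rw [iInf_closureLowerCentral, Subgroup.mem_bot] at this
  exact incl_injective (this.trans (map_one _).symm)

/-- `H` maps onto every quotient of the solution group by a term of its lower central series. -/
theorem exists_mkLowerCentral_eq (n : ℕ) (x : SolutionGroup A H) :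
    ∃ h : H, mkLowerCentral A (SolutionGroup A H) n (of A H h) =
      mkLowerCentral A (SolutionGroup A H) n x := by
  let p := mkLowerCentral A (SolutionGroup A H) n
  -- The elements congruent to an element of `H` modulo `G_n`, pushed into the completion because
  -- the minimality of `closure` is a statement about subgroups there.
  let R := ((p.comp (of A H)).toMonoidHom.range.comap p.toMonoidHom).map (incl A H).toMonoidHom
  have hle : closure A (solutionSet A H) ≤ R := by
    refine closure_le ?_ ?_
    · rintro _ (⟨h, rfl⟩ | ⟨t, ht, hy⟩)
      · exact ⟨of A H h, ⟨h, rfl⟩, rfl⟩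
      · rename_i y
        let y' : SolutionGroup A H := ⟨y, subset_closure _ (Or.inr ⟨t, ht, hy⟩)⟩
        obtain ⟨h, hh⟩ := UnaryTerm.exists_inv_mul_mem_lowerCentral (of A H) ht
          ((eval_eq_one_iff (y := y')).2 hy) n
        refine ⟨y', ⟨h, ?_⟩, rfl⟩
        rw [← mkLowerCentral_eq_one, map_mul, map_inv, inv_mul_eq_one] at hh
        exact hh
    · rintro _ ⟨g, ⟨h, hh⟩, rfl⟩ a
      refine ⟨apow g a, ⟨apow h a, ?_⟩, (incl A H).map_apow g a⟩
      rw [Hom.map_apow', hh]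
      exact (p.map_apow g a).symm
  obtain ⟨x', ⟨h, hh⟩, e⟩ := hle x.2
  obtain rfl : x' = x := incl_injective e
  exact ⟨h, hh⟩

/-- Replacing `x` by an element `k` of `H` congruent to it modulo `G_{n+1}` carries the whole
question over to `H_n / H_{n+1}`. -/
theorem torsionFreeQuotients (htf : TorsionFreeQuotients A (lowerCentral A H)) :
    TorsionFreeQuotients A (lowerCentral A (SolutionGroup A H)) := by
  intro n x a hx ha h
  obtain ⟨k, hk⟩ := exists_mkLowerCentral_eq (n + 1) x
  -- Congruence modulo `G_{n+1}` implies congruence modulo `G_n`, which is what places `k` in `H_n`.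
  have hk' : mkLowerCentral A (SolutionGroup A H) n (of A H k) =
      mkLowerCentral A (SolutionGroup A H) n x :=
    congrArg (transition A (SolutionGroup A H) n) hk
  rw [mkLowerCentral_eq_one.2 hx, mkLowerCentral_eq_one, of_mem_lowerCentral] at hk'
  rw [← mkLowerCentral_eq_one, Hom.map_apow', ← hk, ← Hom.map_apow', ← Hom.map_apow',
    mkLowerCentral_eq_one, of_mem_lowerCentral] at h
  rw [← mkLowerCentral_eq_one, ← hk, mkLowerCentral_eq_one, of_mem_lowerCentral]
  exact htf n k a hk' ha h

theorem of_injective (hres : IsResiduallyANilpotent A H) : Function.Injective (of A H) :=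
  fun _ _ h => toCompletion_injective hres (congrArg (incl A H) h)

end SolutionGroup

end Completion

end AGroup

theorem theorem8p10 {A : Type u} [Ring A] {H : Type v} [Group H] [AGroup A H]
    (hres : AGroup.IsResiduallyANilpotent A H)
    (htf : AGroup.TorsionFreeQuotients A (AGroup.lowerCentral A H)) :
    (∃ (G : Type v) (_ : Group G) (_ : AGroup A G) (ι : AGroup.Hom A H G),
      Function.Injective ι ∧ AGroup.IsResiduallyANilpotent A G ∧
      AGroup.TorsionFreeQuotients A (AGroup.lowerCentral A G) ∧
      ∀ t : AGroup.UnaryTerm A H, IsUnit t.alpha → ∃! y : G, t.eval ι y = 1) ∧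
    (Function.Injective (AGroup.toCompletion A H) ∧
      AGroup.IsResiduallyANilpotent A (AGroup.Completion A H) ∧
      AGroup.IsASeries A (AGroup.closureLowerCentral A H) ∧
      ∀ t : AGroup.UnaryTerm A H, IsUnit t.alpha →
        ∃! y : AGroup.Completion A H, t.eval (AGroup.toCompletion A H) y = 1) ∧
    (AGroup.IsANilpotent A H →
      ∀ t : AGroup.UnaryTerm A H, IsUnit t.alpha →
        ∃! y : H, t.eval (AGroup.Hom.id A H) y = 1) := by
  exact ⟨⟨AGroup.Completion.SolutionGroup A H, inferInstance, inferInstance,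
    AGroup.Completion.SolutionGroup.of A H,
    AGroup.Completion.SolutionGroup.of_injective hres,
    AGroup.Completion.SolutionGroup.isResiduallyANilpotent A H,
    AGroup.Completion.SolutionGroup.torsionFreeQuotients htf,
    fun _ ht => AGroup.Completion.SolutionGroup.existsUnique_eval_eq_one ht⟩,
    ⟨AGroup.Completion.toCompletion_injective hres,
      AGroup.Completion.isResiduallyANilpotent A H,
      AGroup.Completion.isASeries htf,
      fun _ ht => AGroup.Completion.existsUnique_eval_eq_one ht⟩,
    fun hH _ ht => AGroup.UnaryTerm.existsUnique_of_isANilpotent hH ht⟩
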